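/- Let $G$ be a finite simple graph and $k\ge 0$ an integer. Consider colorings $C\colon V(G)\to\{1,\dots,k\}$ of its vertices. Such a coloring is called, with respect to paths, - a unique-maximum coloring if for every path $P$ of $G$ (a single vertex counts as a path) the maximum color on the vertices of $P$ occurs exactly once on $P$; - a conflict-free coloring if for every path $P$ of $G$ some color occurs exactly once on the vertices of $P$; - an odd coloring if for every path $P$ of $G$ some color occurs an odd number of times on the vertices of $P$. Let $\mathrm{UM}(G)$, $\mathrm{CF}(G)$ and $\mathrm{ODD}(G)$ be the least $k$ for which $G$ has, respectively, a unique-maximum, a conflict-free, an odd coloring with $k$ colors with respect to paths. **Theorem.** There is an absolute constant $K$ such that for every finite tree $T$, $$\mathrm{ODD}(T)\ \ge\ \mathrm{UM}(T)^{1/3}-K .$$ Moreover $\mathrm{CF}(T)\ge \mathrm{ODD}(T)$, and consequently $\mathrm{UM}(T)\le(\mathrm{CF}(T)+K)^3$ for every finite tree $T$, with the same constant $K$. -/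

import Mathlib

namespace Hypergraph

variable {V : Type*}

/-- `C` uses only the colours `1, …, k` on the vertices of `H`. -/
def ColorsWith (H : Hypergraph V) (k : ℕ) (C : V → ℕ) : Prop :=
  ∀ v ∈ H.vertexSet, C v ∈ Set.Icc 1 k

/-- The number of vertices of `e` that receive the colour `c`. -/
noncomputable def colorCount (C : V → ℕ) (e : Set V) (c : ℕ) : ℕ :=
  {v | v ∈ e ∧ C v = c}.ncard

/-- Unique-maximum colouring with `k` colours: on each hyperedge the maximum colour occurs
exactly once. -/
def IsUMColoring (H : Hypergraph V) (k : ℕ) (C : V → ℕ) : Prop :=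
  H.ColorsWith k C ∧
    ∀ e ∈ H.edgeSet, ∃ c, IsGreatest (C '' e) c ∧ colorCount C e c = 1

/-- Conflict-free colouring with `k` colours: on each hyperedge some colour occurs exactly once. -/
def IsCFColoring (H : Hypergraph V) (k : ℕ) (C : V → ℕ) : Prop :=
  H.ColorsWith k C ∧ ∀ e ∈ H.edgeSet, ∃ c, colorCount C e c = 1

/-- Odd colouring with `k` colours: on each hyperedge some colour occurs an odd number of times. -/
def IsOddColoring (H : Hypergraph V) (k : ℕ) (C : V → ℕ) : Prop :=
  H.ColorsWith k C ∧ ∀ e ∈ H.edgeSet, ∃ c, Odd (colorCount C e c)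

/-- The unique-maximum chromatic number. (Like the two numbers below, it is an attained minimum
as soon as `V` is finite and no hyperedge is empty.) -/
noncomputable def umChromaticNumber (H : Hypergraph V) : ℕ :=
  sInf {k | ∃ C, H.IsUMColoring k C}

/-- The conflict-free chromatic number. -/
noncomputable def cfChromaticNumber (H : Hypergraph V) : ℕ :=
  sInf {k | ∃ C, H.IsCFColoring k C}

/-- The odd chromatic number. -/
noncomputable def oddChromaticNumber (H : Hypergraph V) : ℕ :=
  sInf {k | ∃ C, H.IsOddColoring k C}

end Hypergraph

namespace SimpleGraph

variable {V : Type*}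

/-- The hypergraph on the vertices of `G` whose hyperedges are the vertex sets of the paths of `G`
(including the one-vertex paths). -/
def pathHypergraph (G : SimpleGraph V) : Hypergraph V where
  vertexSet := Set.univ
  edgeSet := {e | ∃ (u v : V) (p : G.Walk u v), p.IsPath ∧ e = {w | w ∈ p.support}}
  subset_vertexSet_of_mem_edgeSet' := fun _ _ => Set.subset_univ _

/-- The unique-maximum chromatic number of `G` with respect to paths. -/
noncomputable def UM (G : SimpleGraph V) : ℕ := G.pathHypergraph.umChromaticNumber

/-- The conflict-free chromatic number of `G` with respect to paths. -/
noncomputable def CF (G : SimpleGraph V) : ℕ := G.pathHypergraph.cfChromaticNumber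

/-- The odd chromatic number of `G` with respect to paths. -/
noncomputable def ODD (G : SimpleGraph V) : ℕ := G.pathHypergraph.oddChromaticNumber

end SimpleGraph

/-! Let `C` be an odd colouring with k colours. Root the tree and let P(v) in F₂^k be the parity
vector of the root path of v. A path from u to v with lowest common ancestor w has parity P(u) +
P(v) + e_{C w}, which oddness makes nonzero.

Two bounds follow. Along a root path the vectors P are distinct and nonzero, so depths are below 2^k
(`card_ancestors_lt`). If U has colour c and so do all its pairwise common ancestors, the vectors
P(u) and P(u) + e_c, u in U, are all distinct, so |U| ≤ 2^(k-1) (`two_mul_card_le`).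

Hence the rank, summing over colours the bit length of the largest such U below v, is at most k². It
never increases away from the root, and where two branches of equal rank meet it jumps, since the
sets of colour C w in both branches unite (`rank_lt_rank`). Colouring by rank, ties broken by the
2-adic valuation of the depth, is unique-maximum with at most k³ colours: the jump separates
incomparable vertices, the valuation separates comparable ones. So K = 0 suffices. -/

theorem Hypergraph.IsCFColoring.isOddColoring {V : Type*} {H : Hypergraph V} {k : ℕ} {C : V → ℕ}
    (h : H.IsCFColoring k C) : H.IsOddColoring k C := by
  refine ⟨h.1, fun e he => ?_⟩
  obtain ⟨c, hc⟩ := h.2 e he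
  exact ⟨c, hc ▸ odd_one⟩

namespace SimpleGraph

variable {V : Type*}

/-! ### Ancestors and lowest common ancestors in a rooted tree -/

open scoped Classical in
/-- The vertices on the path from the root `r` to `v`. -/
noncomputable def IsTree.ancestors {T : SimpleGraph V} (hT : T.IsTree) (r v : V) : Finset V :=
  (hT.existsUnique_path r v).choose.support.toFinset

variable {T : SimpleGraph V} (hT : T.IsTree) (r : V)

theorem IsTree.mem_ancestors_iff {v a : V} {p : T.Walk r v} (hp : p.IsPath) :
    a ∈ hT.ancestors r v ↔ a ∈ p.support := by
  rw [(hT.existsUnique_path r v).choose_spec.2 p hp]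
  simp [IsTree.ancestors]

theorem IsTree.mem_ancestors_self (v : V) : v ∈ hT.ancestors r v := by
  simp [IsTree.ancestors]

theorem IsTree.root_mem_ancestors (v : V) : r ∈ hT.ancestors r v := by
  simp [IsTree.ancestors]

theorem IsTree.ancestors_subset {v a : V} (ha : a ∈ hT.ancestors r v) :
    hT.ancestors r a ⊆ hT.ancestors r v := by
  classical
  obtain ⟨p, hp, -⟩ := hT.existsUnique_path r v
  intro x hx
  rw [hT.mem_ancestors_iff r hp] at ha ⊢
  rw [hT.mem_ancestors_iff r (hp.takeUntil ha)] at hx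
  exact p.support_takeUntil_subset_support ha hx

theorem IsTree.ancestors_antisymm {a b : V} (ha : a ∈ hT.ancestors r b)
    (hb : b ∈ hT.ancestors r a) : a = b := by
  classical
  obtain ⟨p, hp, -⟩ := hT.existsUnique_path r b
  rw [hT.mem_ancestors_iff r hp] at ha
  rw [hT.mem_ancestors_iff r (hp.takeUntil ha)] at hb
  by_contra hne
  exact Walk.endpoint_notMem_support_takeUntil hp ha (Ne.symm hne) hb

theorem IsTree.exists_isPath_of_mem_ancestors {v a : V} (ha : a ∈ hT.ancestors r v) :
    ∃ q : T.Walk a v, q.IsPath ∧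
      ∀ x, x ∈ q.support ↔ a ∈ hT.ancestors r x ∧ x ∈ hT.ancestors r v := by
  classical
  obtain ⟨p, hp, -⟩ := hT.existsUnique_path r v
  have ha' := (hT.mem_ancestors_iff r hp).1 ha
  have hd : ∀ x ∈ (p.dropUntil a ha').support,
      a ∈ hT.ancestors r x ∧ x ∈ hT.ancestors r v := by
    intro x hx
    have hpath : ((p.takeUntil a ha').append ((p.dropUntil a ha').takeUntil x hx)).IsPath := by
      have : (((p.takeUntil a ha').append ((p.dropUntil a ha').takeUntil x hx)).append
          ((p.dropUntil a ha').dropUntil x hx)).IsPath := by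
        rw [← Walk.append_assoc, Walk.take_spec, Walk.take_spec]
        exact hp
      exact this.of_append_left
    refine ⟨?_, (hT.mem_ancestors_iff r hp).2 (p.support_dropUntil_subset_support ha' hx)⟩
    rw [hT.mem_ancestors_iff r hpath, Walk.mem_support_append_iff]
    exact Or.inl (Walk.end_mem_support _)
  refine ⟨p.dropUntil a ha', hp.dropUntil ha', fun x => ⟨hd x, fun hx => ?_⟩⟩
  have h := (hT.mem_ancestors_iff r hp).1 hx.2
  rw [← Walk.take_spec p ha', Walk.mem_support_append_iff] at h
  rcases h with h | h
  · rw [← hT.mem_ancestors_iff r (hp.takeUntil ha')] at h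
    rw [hT.ancestors_antisymm r h hx.1]
    exact Walk.start_mem_support _
  · exact h

theorem IsTree.mem_ancestors_or_mem_ancestors {v a b : V} (ha : a ∈ hT.ancestors r v)
    (hb : b ∈ hT.ancestors r v) : a ∈ hT.ancestors r b ∨ b ∈ hT.ancestors r a := by
  classical
  obtain ⟨q, hq, hqs⟩ := hT.exists_isPath_of_mem_ancestors r ha
  obtain ⟨p, hp, -⟩ := hT.existsUnique_path r a
  have hpq : (p.append q).IsPath := by
    obtain ⟨p', hp', -⟩ := hT.existsUnique_path r v
    have ha' := (hT.mem_ancestors_iff r hp').1 ha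
    have h1 := (hT.existsUnique_path r a).unique hp (hp'.takeUntil ha')
    have h2 := (hT.existsUnique_path a v).unique hq (hp'.dropUntil ha')
    rw [h1, h2, Walk.take_spec]
    exact hp'
  rw [hT.mem_ancestors_iff r hpq, Walk.mem_support_append_iff,
    ← hT.mem_ancestors_iff r hp, hqs] at hb
  tauto

/-- The witness is the deepest common ancestor; this equation serves throughout to express that `w`
is the lowest common ancestor. -/
theorem IsTree.exists_ancestors_inter_eq [DecidableEq V] (u v : V) :
    ∃ w, hT.ancestors r u ∩ hT.ancestors r v = hT.ancestors r w := by
  obtain ⟨w, hw, hmax⟩ := Finset.exists_max_image (hT.ancestors r u ∩ hT.ancestors r v)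
    (fun w => (hT.ancestors r w).card)
    ⟨r, Finset.mem_inter.2 ⟨hT.root_mem_ancestors r u, hT.root_mem_ancestors r v⟩⟩
  rw [Finset.mem_inter] at hw
  refine ⟨w, subset_antisymm (fun x hx => ?_) (Finset.subset_inter
    (hT.ancestors_subset r hw.1) (hT.ancestors_subset r hw.2))⟩
  have hle := hmax x hx
  rw [Finset.mem_inter] at hx
  rcases hT.mem_ancestors_or_mem_ancestors r hx.1 hw.1 with h | h
  · exact h
  · rw [Finset.eq_of_subset_of_card_le (hT.ancestors_subset r h) hle]
    exact hT.mem_ancestors_self r x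

theorem IsTree.exists_isPath_of_ancestors_inter_eq [DecidableEq V] {u v w : V}
    (h : hT.ancestors r u ∩ hT.ancestors r v = hT.ancestors r w) :
    ∃ p : T.Walk u v, p.IsPath ∧ ∀ x, x ∈ p.support ↔
      w ∈ hT.ancestors r x ∧ (x ∈ hT.ancestors r u ∨ x ∈ hT.ancestors r v) := by
  have hw := hT.mem_ancestors_self r w
  rw [← h, Finset.mem_inter] at hw
  obtain ⟨p, hp, hps⟩ := hT.exists_isPath_of_mem_ancestors r hw.1
  obtain ⟨q, hq, hqs⟩ := hT.exists_isPath_of_mem_ancestors r hw.2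
  refine ⟨p.reverse.append q, ?_, fun x => ?_⟩
  · have hq' := hq.support_nodup
    rw [← Walk.cons_tail_support, List.nodup_cons] at hq'
    rw [Walk.isPath_def, Walk.support_append, List.nodup_append']
    refine ⟨hp.reverse.support_nodup, hq'.2, fun x hx hx' => ?_⟩
    rw [Walk.support_reverse, List.mem_reverse, hps] at hx
    have hx2 := (hqs x).1 (List.mem_of_mem_tail hx')
    have hxw : x ∈ hT.ancestors r w := by
      rw [← h]
      exact Finset.mem_inter.2 ⟨hx.2, hx2.2⟩
    rw [hT.ancestors_antisymm r hxw hx.1] at hx'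
    exact hq'.1 hx'
  · rw [Walk.mem_support_append_iff, Walk.support_reverse, List.mem_reverse, hps, hqs]
    tauto

theorem IsTree.card_ancestors_pos (v : V) : 0 < (hT.ancestors r v).card :=
  Finset.card_pos.2 ⟨v, hT.mem_ancestors_self r v⟩

theorem IsTree.exists_mem_ancestors_card_eq {v : V} {m : ℕ} (h1 : 1 ≤ m)
    (hm : m ≤ (hT.ancestors r v).card) :
    ∃ w ∈ hT.ancestors r v, (hT.ancestors r w).card = m := by
  -- Depth is injective on the chain of ancestors, and `Finset.Icc 1 _` has the same size, so every
  -- depth is attained.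
  obtain ⟨w, hw, h⟩ := Finset.surj_on_of_inj_on_of_card_le (s := hT.ancestors r v)
    (t := Finset.Icc 1 (hT.ancestors r v).card) (fun w _ => (hT.ancestors r w).card)
    (fun w hw => Finset.mem_Icc.2
      ⟨hT.card_ancestors_pos r w,
        Finset.card_le_card (hT.ancestors_subset r hw)⟩)
    (fun a b ha hb hab => by
      rcases hT.mem_ancestors_or_mem_ancestors r ha hb with h | h
      · have := Finset.eq_of_subset_of_card_le (hT.ancestors_subset r h) hab.ge
        exact hT.ancestors_antisymm r h (this ▸ hT.mem_ancestors_self r b)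
      · have := Finset.eq_of_subset_of_card_le (hT.ancestors_subset r h) hab.le
        exact hT.ancestors_antisymm r (this ▸ hT.mem_ancestors_self r a) h)
    (by simp) m (Finset.mem_Icc.2 ⟨h1, hm⟩)
  exact ⟨w, hw, h.symm⟩

/-! ### Parity vectors and the depth bound -/

/-- The parity vector of a set of coloured vertices. -/
noncomputable def parity {ι : Type*} (C : V → ι) (s : Finset V) : ι → ZMod 2 :=
  open scoped Classical in ∑ a ∈ s, Pi.single (C a) 1

/-- A colouring `C` is odd with respect to paths: no path has zero parity vector. -/
def IsOddOnPaths {ι : Type*} (T : SimpleGraph V) (C : V → ι) : Prop :=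
  ∀ (s : Finset V) (u v : V) (p : T.Walk u v), p.IsPath → (∀ x, x ∈ p.support ↔ x ∈ s) →
    parity C s ≠ 0

section Parity

variable {ι : Type*} {C : V → ι}

theorem parity_singleton [DecidableEq ι] (a : V) : parity C {a} = Pi.single (C a) 1 := by
  simp [parity]
  congr!

theorem parity_union_add_parity_inter [DecidableEq V] (s t : Finset V) :
    parity C (s ∪ t) + parity C (s ∩ t) = parity C s + parity C t :=
  Finset.sum_union_inter

theorem add_self_eq_zero_zmod_two (f : ι → ZMod 2) : f + f = 0 :=
  funext fun _ => CharTwo.add_self_eq_zero _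

theorem parity_filter_ancestors [DecidableEq V] {u w : V} (hw : w ∈ hT.ancestors r u) :
    parity C {x ∈ hT.ancestors r u | w ∈ hT.ancestors r x} =
      parity C (hT.ancestors r u) + parity C (hT.ancestors r w) + parity C {w} := by
  have h := parity_union_add_parity_inter (C := C)
    {x ∈ hT.ancestors r u | w ∈ hT.ancestors r x} (hT.ancestors r w)
  have h1 : {x ∈ hT.ancestors r u | w ∈ hT.ancestors r x} ∪ hT.ancestors r w =
      hT.ancestors r u := by
    ext x
    have := hT.mem_ancestors_or_mem_ancestors r hw (b := x)
    have := @hT.ancestors_subset _ _ r _ _ hw x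
    simp only [Finset.mem_union, Finset.mem_filter]
    tauto
  have h2 : {x ∈ hT.ancestors r u | w ∈ hT.ancestors r x} ∩ hT.ancestors r w = {w} := by
    ext x
    simp only [Finset.mem_inter, Finset.mem_filter, Finset.mem_singleton]
    constructor
    · rintro ⟨⟨-, h⟩, h'⟩
      exact hT.ancestors_antisymm r h' h
    · rintro rfl
      exact ⟨⟨hw, hT.mem_ancestors_self r _⟩, hT.mem_ancestors_self r _⟩
  rw [h1, h2] at h
  linear_combination (exp := 1) -h - add_self_eq_zero_zmod_two (parity C (hT.ancestors r w))

/-- The first claim is oddness of the path from `u` to `v`; the second is oddness of that path with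
its endpoint `u` deleted. -/
theorem IsOddOnPaths.of_ancestors_inter_eq [DecidableEq V] (hC : T.IsOddOnPaths C) {u v w : V}
    (h : hT.ancestors r u ∩ hT.ancestors r v = hT.ancestors r w) :
    parity C (hT.ancestors r u) + parity C (hT.ancestors r v) + parity C {w} ≠ 0 ∧
    (u ≠ v → parity C (hT.ancestors r u) + parity C (hT.ancestors r v) + parity C {w} ≠
      parity C {u}) := by
  have hw := hT.mem_ancestors_self r w
  rw [← h, Finset.mem_inter] at hw
  obtain ⟨p, hp, hps⟩ := hT.exists_isPath_of_ancestors_inter_eq r h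
  have hps' : ∀ x, x ∈ p.support ↔ x ∈ {x ∈ hT.ancestors r u | w ∈ hT.ancestors r x} ∪
      {x ∈ hT.ancestors r v | w ∈ hT.ancestors r x} := by
    intro x
    rw [hps]
    simp only [Finset.mem_union, Finset.mem_filter]
    tauto
  have key : parity C ({x ∈ hT.ancestors r u | w ∈ hT.ancestors r x} ∪
      {x ∈ hT.ancestors r v | w ∈ hT.ancestors r x}) =
      parity C (hT.ancestors r u) + parity C (hT.ancestors r v) + parity C {w} := by
    have h1 := parity_union_add_parity_inter (C := C)
      {x ∈ hT.ancestors r u | w ∈ hT.ancestors r x} {x ∈ hT.ancestors r v | w ∈ hT.ancestors r x}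
    have h2 : {x ∈ hT.ancestors r u | w ∈ hT.ancestors r x} ∩
        {x ∈ hT.ancestors r v | w ∈ hT.ancestors r x} = {w} := by
      rw [← Finset.filter_inter_distrib, h]
      ext x
      simp only [Finset.mem_filter, Finset.mem_singleton]
      constructor
      · rintro ⟨h', h⟩
        exact hT.ancestors_antisymm r h' h
      · rintro rfl
        exact ⟨hT.mem_ancestors_self r _, hT.mem_ancestors_self r _⟩
    rw [h2, parity_filter_ancestors hT r hw.1, parity_filter_ancestors hT r hw.2] at h1
    linear_combination (exp := 1) h1 +
      add_self_eq_zero_zmod_two (parity C (hT.ancestors r w))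
  rw [← key]
  refine ⟨hC _ _ _ p hp hps', fun huv heq => ?_⟩
  generalize {x ∈ hT.ancestors r u | w ∈ hT.ancestors r x} ∪
      {x ∈ hT.ancestors r v | w ∈ hT.ancestors r x} = s at *
  cases p with
  | nil => exact huv rfl
  | cons hadj q =>
    rw [Walk.cons_isPath_iff] at hp
    have hu : u ∈ s := (hps' u).1 (Walk.start_mem_support _)
    refine hC (s.erase u) _ _ q hp.1 (fun x => ?_) ?_
    · rw [Finset.mem_erase, ← hps', Walk.support_cons, List.mem_cons]
      constructor
      · intro hx
        exact ⟨fun h => hp.2 (h ▸ hx), Or.inr hx⟩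
      · tauto
    · have := Finset.sum_erase_add s (fun a => (open scoped Classical in
        Pi.single (C a) 1 : ι → ZMod 2)) hu
      rw [parity, parity, Finset.sum_singleton, ← this] at heq
      simpa [parity] using heq

variable [Fintype ι]

theorem IsOddOnPaths.card_ancestors_lt (hC : T.IsOddOnPaths C) (v : V) :
    (hT.ancestors r v).card < 2 ^ Fintype.card ι := by
  classical
  have hinj : Set.InjOn (fun a => parity C (hT.ancestors r a)) (hT.ancestors r v) := by
    have key : ∀ a b, a ∈ hT.ancestors r b → a ≠ b →
        parity C (hT.ancestors r a) ≠ parity C (hT.ancestors r b) := by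
      intro a b hab hne heq
      refine (hC.of_ancestors_inter_eq hT r
        (Finset.inter_eq_left.2 (hT.ancestors_subset r hab))).2 hne ?_
      rw [heq, add_self_eq_zero_zmod_two, zero_add]
    intro a ha b hb hab
    by_contra hne
    rcases hT.mem_ancestors_or_mem_ancestors r ha hb with h | h
    · exact key a b h hne hab
    · exact key b a h (Ne.symm hne) hab.symm
  have hne : ∀ a, parity C (hT.ancestors r a) ≠ 0 := by
    intro a
    obtain ⟨p, hp, -⟩ := hT.existsUnique_path r a
    exact hC _ _ _ p hp fun x => (hT.mem_ancestors_iff r hp).symm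
  calc (hT.ancestors r v).card
      = ((hT.ancestors r v).image (fun a => parity C (hT.ancestors r a))).card :=
        (Finset.card_image_of_injOn hinj).symm
    _ ≤ ((Finset.univ : Finset (ι → ZMod 2)).erase 0).card := by
        refine Finset.card_le_card fun f hf => ?_
        obtain ⟨a, -, rfl⟩ := Finset.mem_image.1 hf
        exact Finset.mem_erase.2 ⟨hne a, Finset.mem_univ _⟩
    _ < (Finset.univ : Finset (ι → ZMod 2)).card :=
        Finset.card_erase_lt_of_mem (Finset.mem_univ _)
    _ = 2 ^ Fintype.card ι := by simp [ZMod.card]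

theorem IsOddOnPaths.padicValNat_card_ancestors_lt (hC : T.IsOddOnPaths C) (v : V) :
    padicValNat 2 (hT.ancestors r v).card < Fintype.card ι := by
  refine (Nat.pow_lt_pow_iff_right (a := 2) (by norm_num)).1
    (lt_of_le_of_lt ?_ (hC.card_ancestors_lt hT r v))
  exact Nat.le_of_dvd (hT.card_ancestors_pos r v) pow_padicValNat_dvd

end Parity

/-! ### Monochromatic branching sets and rank -/

/-- A set of vertices of colour `c` all of whose pairwise lowest common ancestors have colour `c`. -/
def IsTree.IsMonochromaticBranching {ι : Type*} (C : V → ι) (c : ι) (U : Finset V) : Prop :=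
  (∀ u ∈ U, C u = c) ∧ ∀ u ∈ U, ∀ v ∈ U, ∀ w,
    (∀ x, x ∈ hT.ancestors r w ↔ x ∈ hT.ancestors r u ∧ x ∈ hT.ancestors r v) → C w = c

theorem IsOddOnPaths.two_mul_card_le {ι : Type*} [Fintype ι] {C : V → ι}
    (hC : T.IsOddOnPaths C) {c : ι} {U : Finset V} (hU : hT.IsMonochromaticBranching r C c U) :
    2 * U.card ≤ 2 ^ Fintype.card ι := by
  classical
  have hlca : ∀ u ∈ U, ∀ v ∈ U,
      parity C (hT.ancestors r u) + parity C (hT.ancestors r v) + Pi.single c 1 ≠ 0 ∧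
      (u ≠ v → parity C (hT.ancestors r u) + parity C (hT.ancestors r v) ≠ 0) := by
    intro u hu v hv
    obtain ⟨w, hw⟩ := hT.exists_ancestors_inter_eq r u v
    have hwc : C w = c := hU.2 u hu v hv w fun x => by rw [← hw, Finset.mem_inter]
    have h := hC.of_ancestors_inter_eq hT r hw
    rw [parity_singleton, parity_singleton, hwc, hU.1 u hu] at h
    refine ⟨h.1, fun huv h0 => h.2 huv ?_⟩
    rw [h0, zero_add]
  have hinj : Set.InjOn (fun u => parity C (hT.ancestors r u)) U := by
    intro u hu v hv huv
    by_contra hne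
    refine (hlca u hu v hv).2 hne ?_
    simp only at huv
    rw [huv, add_self_eq_zero_zmod_two]
  have hdisj : Disjoint (U.image fun u => parity C (hT.ancestors r u))
      (U.image fun u => parity C (hT.ancestors r u) + Pi.single c 1) := by
    rw [Finset.disjoint_left]
    intro f hf hf'
    obtain ⟨u, hu, rfl⟩ := Finset.mem_image.1 hf
    obtain ⟨v, hv, h⟩ := Finset.mem_image.1 hf'
    refine (hlca u hu v hv).1 ?_
    rw [add_assoc, h, add_self_eq_zero_zmod_two]
  have hcard := Finset.card_le_univ ((U.image fun u => parity C (hT.ancestors r u)) ∪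
      (U.image fun u => parity C (hT.ancestors r u) + Pi.single c 1))
  rw [Finset.card_union_of_disjoint hdisj, Finset.card_image_of_injOn hinj,
    Finset.card_image_of_injOn (fun u hu v hv h => hinj hu hv (add_right_cancel h))] at hcard
  simpa [two_mul, ZMod.card] using hcard

section Rank

variable [Fintype V] {ι : Type*} (C : V → ι)

open scoped Classical in
/-- The largest size of a monochromatic branching set of colour `c` below `v`. -/
noncomputable def IsTree.branchingNumber (c : ι) (v : V) : ℕ :=
  Finset.univ.sup fun U : Finset V =>
    if hT.IsMonochromaticBranching r C c U ∧ ∀ u ∈ U, v ∈ hT.ancestors r u then U.card else 0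

variable {C}

theorem IsTree.card_le_branchingNumber {c : ι} {v : V} {U : Finset V}
    (hU : hT.IsMonochromaticBranching r C c U) (h : ∀ u ∈ U, v ∈ hT.ancestors r u) :
    U.card ≤ hT.branchingNumber r C c v := by
  classical
  have := Finset.le_sup (f := fun U : Finset V =>
    if hT.IsMonochromaticBranching r C c U ∧ ∀ u ∈ U, v ∈ hT.ancestors r u then U.card else 0)
    (Finset.mem_univ U)
  rwa [if_pos (And.intro hU h)] at this

variable (C) in
theorem IsTree.exists_card_eq_branchingNumber (c : ι) (v : V) :
    ∃ U : Finset V, hT.IsMonochromaticBranching r C c U ∧ (∀ u ∈ U, v ∈ hT.ancestors r u) ∧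
      U.card = hT.branchingNumber r C c v := by
  classical
  obtain ⟨U, -, hU⟩ := Finset.exists_mem_eq_sup Finset.univ Finset.univ_nonempty
    (fun U : Finset V => if hT.IsMonochromaticBranching r C c U ∧
      ∀ u ∈ U, v ∈ hT.ancestors r u then U.card else 0)
  by_cases h : hT.IsMonochromaticBranching r C c U ∧ ∀ u ∈ U, v ∈ hT.ancestors r u
  · rw [if_pos h] at hU
    exact ⟨U, h.1, h.2, hU.symm⟩
  -- The supremum is then the default value 0, attained by the empty set.
  · rw [if_neg h] at hU
    exact ⟨∅, by simp [IsTree.IsMonochromaticBranching], by simp, hU.symm⟩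

theorem IsTree.branchingNumber_mono (c : ι) {u w : V} (h : w ∈ hT.ancestors r u) :
    hT.branchingNumber r C c u ≤ hT.branchingNumber r C c w := by
  obtain ⟨U, hU, hUu, hcard⟩ := hT.exists_card_eq_branchingNumber r C c u
  rw [← hcard]
  exact hT.card_le_branchingNumber r hU fun x hx => hT.ancestors_subset r (hUu x hx) h

theorem IsTree.one_le_branchingNumber (v : V) : 1 ≤ hT.branchingNumber r C (C v) v := by
  refine hT.card_le_branchingNumber r (U := {v}) ⟨by simp, ?_⟩ (by simp [hT.mem_ancestors_self])
  simp only [Finset.mem_singleton]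
  rintro u rfl v rfl w hw
  simp only [and_self] at hw
  rw [hT.ancestors_antisymm r ((hw w).1 (hT.mem_ancestors_self r w))
    ((hw v).2 (hT.mem_ancestors_self r v))]

/-- Optimal sets below `u` and `v` are disjoint, and a cross pair always has lowest common ancestor
`w`, whose colour is the right one; so their union still qualifies. -/
theorem IsTree.branchingNumber_add_le [DecidableEq V] {u v w : V}
    (h : hT.ancestors r u ∩ hT.ancestors r v = hT.ancestors r w) (hu : u ≠ w) (hv : v ≠ w) :
    hT.branchingNumber r C (C w) u + hT.branchingNumber r C (C w) v ≤
      hT.branchingNumber r C (C w) w := by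
  obtain ⟨A, hA, hAu, hAcard⟩ := hT.exists_card_eq_branchingNumber r C (C w) u
  obtain ⟨B, hB, hBv, hBcard⟩ := hT.exists_card_eq_branchingNumber r C (C w) v
  have hw := hT.mem_ancestors_self r w
  rw [← h, Finset.mem_inter] at hw
  have huv : u ∉ hT.ancestors r v := fun huv => by
    have : u ∈ hT.ancestors r w := by
      rw [← h]
      exact Finset.mem_inter.2 ⟨hT.mem_ancestors_self r u, huv⟩
    exact hu (hT.ancestors_antisymm r this hw.1)
  have hvu : v ∉ hT.ancestors r u := fun hvu => by
    have : v ∈ hT.ancestors r w := by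
      rw [← h]
      exact Finset.mem_inter.2 ⟨hvu, hT.mem_ancestors_self r v⟩
    exact hv (hT.ancestors_antisymm r this hw.2)
  have hcross : ∀ a, u ∈ hT.ancestors r a → ∀ b, v ∈ hT.ancestors r b → ∀ x,
      (x ∈ hT.ancestors r a ∧ x ∈ hT.ancestors r b ↔ x ∈ hT.ancestors r w) := by
    intro a ha b hb x
    rw [← h, Finset.mem_inter]
    refine ⟨fun hx => ?_, fun hx => ⟨hT.ancestors_subset r ha hx.1, hT.ancestors_subset r hb hx.2⟩⟩
    have hxu : x ∈ hT.ancestors r u ∨ u ∈ hT.ancestors r x :=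
      hT.mem_ancestors_or_mem_ancestors r hx.1 ha
    have hxv : x ∈ hT.ancestors r v ∨ v ∈ hT.ancestors r x :=
      hT.mem_ancestors_or_mem_ancestors r hx.2 hb
    have hub : u ∉ hT.ancestors r b := fun hub => by
      rcases hT.mem_ancestors_or_mem_ancestors r hub hb with h | h
      · exact huv h
      · exact hvu h
    have hva : v ∉ hT.ancestors r a := fun hva => by
      rcases hT.mem_ancestors_or_mem_ancestors r hva ha with h | h
      · exact hvu h
      · exact huv h
    exact ⟨hxu.resolve_right fun h => hub (hT.ancestors_subset r hx.2 h),
      hxv.resolve_right fun h => hva (hT.ancestors_subset r hx.1 h)⟩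
  have hdisj : Disjoint A B := by
    rw [Finset.disjoint_left]
    intro x hxA hxB
    rcases hT.mem_ancestors_or_mem_ancestors r (hAu x hxA) (hBv x hxB) with h | h
    · exact huv h
    · exact hvu h
  have heq : ∀ z, (∀ x, x ∈ hT.ancestors r z ↔ x ∈ hT.ancestors r w) → C z = C w := fun z hz => by
    rw [hT.ancestors_antisymm r ((hz z).1 (hT.mem_ancestors_self r z))
      ((hz w).2 (hT.mem_ancestors_self r w))]
  rw [← hAcard, ← hBcard, ← Finset.card_union_of_disjoint hdisj]
  refine hT.card_le_branchingNumber r ⟨fun x hx => ?_, fun a ha b hb z hz => ?_⟩ fun x hx => ?_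
  · rcases Finset.mem_union.1 hx with hx | hx
    · exact hA.1 x hx
    · exact hB.1 x hx
  · rcases Finset.mem_union.1 ha with ha | ha <;> rcases Finset.mem_union.1 hb with hb | hb
    · exact hA.2 a ha b hb z hz
    · exact heq z fun x => (hz x).trans (hcross a (hAu a ha) b (hBv b hb) x)
    · exact heq z fun x => (hz x).trans
        (and_comm.trans (hcross b (hAu b hb) a (hBv a ha) x))
    · exact hB.2 a ha b hb z hz
  · rcases Finset.mem_union.1 hx with hx | hx
    · exact hT.ancestors_subset r (hAu x hx) hw.1
    · exact hT.ancestors_subset r (hBv x hx) hw.2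

variable [Fintype ι]

variable (C) in
/-- The sum over all colours of the bit lengths of the branching numbers. -/
noncomputable def IsTree.rank (v : V) : ℕ := ∑ c, (hT.branchingNumber r C c v).size

theorem IsTree.rank_mono {u w : V} (h : w ∈ hT.ancestors r u) :
    hT.rank r C u ≤ hT.rank r C w :=
  Finset.sum_le_sum fun c _ => Nat.size_le_size (hT.branchingNumber_mono r c h)

theorem IsTree.one_le_rank (v : V) : 1 ≤ hT.rank r C v :=
  (Nat.size_pos.2 (hT.one_le_branchingNumber r v)).trans_le
    (Finset.single_le_sum (f := fun c => (hT.branchingNumber r C c v).size)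
      (fun _ _ => Nat.zero_le _) (Finset.mem_univ (C v)))

theorem IsOddOnPaths.rank_le (hC : T.IsOddOnPaths C) (v : V) :
    hT.rank r C v ≤ Fintype.card ι * Fintype.card ι := by
  refine (Finset.sum_le_card_nsmul _ _ (Fintype.card ι) fun c _ => ?_).trans_eq (by simp)
  obtain ⟨U, hU, -, hcard⟩ := hT.exists_card_eq_branchingNumber r C c v
  have := hC.two_mul_card_le hT r hU
  have : 0 < 2 ^ Fintype.card ι := by positivity
  rw [Nat.size_le]
  lia

theorem IsTree.rank_lt_rank [DecidableEq V] {u v w : V}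
    (h : hT.ancestors r u ∩ hT.ancestors r v = hT.ancestors r w) (hu : u ≠ w) (hv : v ≠ w)
    (huv : hT.rank r C u = hT.rank r C v) : hT.rank r C u < hT.rank r C w := by
  have hw := hT.mem_ancestors_self r w
  rw [← h, Finset.mem_inter] at hw
  by_contra hlt
  have heq : ∀ x, w ∈ hT.ancestors r x → hT.rank r C w ≤ hT.rank r C x →
      ∀ c, (hT.branchingNumber r C c x).size = (hT.branchingNumber r C c w).size := by
    intro x hx hle c
    have hmono : ∀ c ∈ Finset.univ,
        (hT.branchingNumber r C c x).size ≤ (hT.branchingNumber r C c w).size :=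
      fun c _ => Nat.size_le_size (hT.branchingNumber_mono r c hx)
    exact (Finset.sum_eq_sum_iff_of_le hmono).1 ((hT.rank_mono r hx).antisymm hle) c
      (Finset.mem_univ c)
  have h1 := heq u hw.1 (not_lt.1 hlt) (C w)
  have h2 := heq v hw.2 (huv ▸ not_lt.1 hlt) (C w)
  have h3 := hT.branchingNumber_add_le (C := C) r h hu hv
  -- Bit length d + 1 means a value of at least 2^d; if neither branch loses bits, the sum reaches
  -- 2^(d+1) and needs one bit more.
  have h4 := Nat.size_pos.2 (hT.one_le_branchingNumber (C := C) r w)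
  obtain ⟨d, hd⟩ := Nat.exists_eq_succ_of_ne_zero h4.ne'
  have h5 : 2 ^ d ≤ hT.branchingNumber r C (C w) u := Nat.lt_size.1 (by lia)
  have h6 : 2 ^ d ≤ hT.branchingNumber r C (C w) v := Nat.lt_size.1 (by lia)
  have h7 : d + 1 < (hT.branchingNumber r C (C w) w).size :=
    Nat.lt_size.2 (by rw [pow_succ]; lia)
  lia

end Rank

/-! ### The colouring by rank and 2-adic valuation of depth -/

theorem exists_padicValNat_two_lt {a b : ℕ} (ha : 0 < a) (hab : a < b)
    (h : padicValNat 2 a = padicValNat 2 b) :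
    ∃ m, a < m ∧ m < b ∧ padicValNat 2 a < padicValNat 2 m := by
  obtain ⟨n, hn⟩ : ∃ n, padicValNat 2 a = n := ⟨_, rfl⟩
  rw [hn] at h ⊢
  obtain ⟨a', rfl⟩ : 2 ^ n ∣ a := hn ▸ pow_padicValNat_dvd
  obtain ⟨b', rfl⟩ : 2 ^ n ∣ b := h ▸ pow_padicValNat_dvd
  have hpos : 0 < 2 ^ n := by positivity
  have hlt : a' < b' := lt_of_mul_lt_mul_left hab hpos.le
  have hodd : ∀ x, 2 ^ n * x ≠ 0 → padicValNat 2 (2 ^ n * x) = n → ¬ 2 ∣ x := by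
    rintro x hx hxn ⟨y, rfl⟩
    have : 2 ^ (n + 1) ∣ 2 ^ n * (2 * y) := ⟨y, by ring⟩
    rw [padicValNat_dvd_iff_le hx] at this
    lia
  have h1 := hodd a' ha.ne' hn
  have h2 := hodd b' (by lia) h.symm
  -- Both `a'` and `b'` are odd, so the even number `a' + 1` lies strictly between them.
  refine ⟨2 ^ n * (a' + 1), by gcongr; lia, by gcongr; lia, ?_⟩
  obtain ⟨y, hy⟩ : 2 ∣ a' + 1 := by lia
  have : 2 ^ (n + 1) ∣ 2 ^ n * (a' + 1) := ⟨y, by rw [hy]; ring⟩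
  rwa [padicValNat_dvd_iff_le (by positivity)] at this

section Coloring

variable [Fintype V] {ι : Type*} [Fintype ι] (C : V → ι)

/-- The colouring ordered by rank first, then by the 2-adic valuation of the depth. -/
noncomputable def IsTree.rankColoring (v : V) : ℕ :=
  (hT.rank r C v - 1) * Fintype.card ι + padicValNat 2 (hT.ancestors r v).card + 1

variable {C}

/-- Valuations are below the number of colours, so distinct ranks fill disjoint blocks; ranks are
positive, so subtracting 1 loses nothing. -/
theorem IsOddOnPaths.rankColoring_lt_of_rank_lt (hC : T.IsOddOnPaths C) {u w : V}
    (h : hT.rank r C u < hT.rank r C w) : hT.rankColoring r C u < hT.rankColoring r C w := by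
  have h1 := hT.one_le_rank (C := C) r u
  have h2 := hC.padicValNat_card_ancestors_lt hT r u
  have h3 : (hT.rank r C u - 1 + 1) * Fintype.card ι ≤ (hT.rank r C w - 1) * Fintype.card ι :=
    Nat.mul_le_mul_right _ (by lia)
  rw [add_mul, one_mul] at h3
  unfold IsTree.rankColoring
  lia

theorem IsOddOnPaths.rankColoring_le (hC : T.IsOddOnPaths C) (v : V) :
    hT.rankColoring r C v ≤ Fintype.card ι ^ 3 := by
  have h1 := hT.one_le_rank (C := C) r v
  have h2 := hC.padicValNat_card_ancestors_lt hT r v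
  have h3 : (hT.rank r C v - 1 + 1) * Fintype.card ι ≤
      (Fintype.card ι * Fintype.card ι) * Fintype.card ι :=
    Nat.mul_le_mul_right _ (by have := hC.rank_le hT r v; lia)
  rw [add_mul, one_mul] at h3
  unfold IsTree.rankColoring
  rw [pow_succ, pow_two]
  lia

theorem IsOddOnPaths.exists_rankColoring_lt_of_mem_ancestors (hC : T.IsOddOnPaths C) {u v : V}
    (huv : u ∈ hT.ancestors r v) (hne : u ≠ v)
    (h : hT.rankColoring r C u = hT.rankColoring r C v) :
    ∃ x, u ∈ hT.ancestors r x ∧ x ∈ hT.ancestors r v ∧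
      hT.rankColoring r C u < hT.rankColoring r C x := by
  have hrank : hT.rank r C u = hT.rank r C v := by
    by_contra hr
    rcases lt_or_gt_of_ne hr with hr | hr
    · exact (hC.rankColoring_lt_of_rank_lt hT r hr).ne h
    · exact (hC.rankColoring_lt_of_rank_lt hT r hr).ne' h
  have hval : padicValNat 2 (hT.ancestors r u).card = padicValNat 2 (hT.ancestors r v).card := by
    unfold IsTree.rankColoring at h
    rw [hrank] at h
    lia
  have hcard : (hT.ancestors r u).card < (hT.ancestors r v).card := by
    refine Finset.card_lt_card ((hT.ancestors_subset r huv).ssubset_of_mem_notMem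
      (hT.mem_ancestors_self r v) fun hvu => hne (hT.ancestors_antisymm r huv hvu))
  obtain ⟨m, hm1, hm2, hm⟩ := exists_padicValNat_two_lt (hT.card_ancestors_pos r u) hcard hval
  obtain ⟨x, hx, rfl⟩ := hT.exists_mem_ancestors_card_eq r (v := v) (by lia) hm2.le
  have hux : u ∈ hT.ancestors r x := by
    refine (hT.mem_ancestors_or_mem_ancestors r huv hx).resolve_right fun hxu => ?_
    exact hm1.not_ge (Finset.card_le_card (hT.ancestors_subset r hxu))
  -- Monotonicity squeezes the rank of `x` between the equal ranks of `u` and `v`, leaving the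
  -- valuation to decide.
  have hrx : hT.rank r C u = hT.rank r C x :=
    le_antisymm (hrank.trans_le (hT.rank_mono r hx)) (hT.rank_mono r hux)
  refine ⟨x, hux, hx, ?_⟩
  unfold IsTree.rankColoring
  rw [hrx]
  lia

theorem IsOddOnPaths.exists_rankColoring_lt (hC : T.IsOddOnPaths C) {u v : V} (hne : u ≠ v)
    (h : hT.rankColoring r C u = hT.rankColoring r C v) (p : T.Walk u v) (hp : p.IsPath) :
    ∃ x ∈ p.support, hT.rankColoring r C u < hT.rankColoring r C x := by
  classical
  obtain ⟨w, hw⟩ := hT.exists_ancestors_inter_eq r u v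
  obtain ⟨q, hq, hqs⟩ := hT.exists_isPath_of_ancestors_inter_eq r hw
  obtain rfl := (hT.existsUnique_path u v).unique hp hq
  simp only [hqs]
  have hwm := hT.mem_ancestors_self r w
  rw [← hw, Finset.mem_inter] at hwm
  by_cases hu : u = w
  · obtain ⟨x, hx1, hx2, hx⟩ := hC.exists_rankColoring_lt_of_mem_ancestors hT r
      (hu ▸ hwm.2) hne h
    exact ⟨x, ⟨hu ▸ hx1, Or.inr hx2⟩, hx⟩
  by_cases hv : v = w
  · obtain ⟨x, hx1, hx2, hx⟩ := hC.exists_rankColoring_lt_of_mem_ancestors hT r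
      (hv ▸ hwm.1) hne.symm h.symm
    exact ⟨x, ⟨hv ▸ hx1, Or.inl hx2⟩, h ▸ hx⟩
  refine ⟨w, ⟨hT.mem_ancestors_self r w, Or.inl hwm.1⟩, hC.rankColoring_lt_of_rank_lt hT r ?_⟩
  refine hT.rank_lt_rank r hw hu hv ?_
  by_contra hr
  rcases lt_or_gt_of_ne hr with hr | hr
  · exact (hC.rankColoring_lt_of_rank_lt hT r hr).ne h
  · exact (hC.rankColoring_lt_of_rank_lt hT r hr).ne' h

end Coloring

/-! ### Transfer to the hypergraph colourings -/

/-- If any two equally coloured vertices are separated by a larger colour on each path between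
them, then the colouring is a unique-maximum colouring. -/
theorem isUMColoring_of_forall_exists_lt [Finite V] {k : ℕ} {D : V → ℕ}
    (hD : ∀ v, D v ∈ Set.Icc 1 k)
    (h : ∀ u v, u ≠ v → D u = D v → ∀ p : T.Walk u v, p.IsPath → ∃ x ∈ p.support, D u < D x) :
    T.pathHypergraph.IsUMColoring k D := by
  classical
  refine ⟨fun v _ => hD v, ?_⟩
  rintro _ ⟨u, v, p, hp, rfl⟩
  obtain ⟨a, ha, hmax⟩ := Set.exists_max_image {w | w ∈ p.support} D (Set.toFinite _)
    ⟨u, p.start_mem_support⟩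
  have hsub : ∀ b ∈ p.support, a ≠ b → D a = D b → False := by
    intro b hb hab hDab
    have hb' := hb
    rw [← Walk.take_spec p ha, Walk.mem_support_append_iff] at hb'
    rcases hb' with hb' | hb'
    · obtain ⟨x, hx, hlt⟩ := h b a hab.symm hDab.symm _ ((hp.takeUntil ha).dropUntil hb')
      have := hmax x (p.support_takeUntil_subset_support ha
        (Walk.support_dropUntil_subset_support _ hb' hx))
      lia
    · obtain ⟨x, hx, hlt⟩ := h a b hab hDab _ ((hp.dropUntil ha).takeUntil hb')
      have := hmax x (p.support_dropUntil_subset_support ha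
        (Walk.support_takeUntil_subset_support _ hb' hx))
      lia
  refine ⟨D a, ⟨⟨a, ha, rfl⟩, ?_⟩, ?_⟩
  · rintro _ ⟨b, hb, rfl⟩
    exact hmax b hb
  · rw [Hypergraph.colorCount, Set.ncard_eq_one]
    refine ⟨a, Set.eq_singleton_iff_unique_mem.2 ⟨⟨ha, rfl⟩, ?_⟩⟩
    rintro b ⟨hb, hDb⟩
    by_contra hne
    exact hsub b hb (Ne.symm hne) hDb.symm

theorem isOddOnPaths_of_isOddColoring {k : ℕ} {C : V → ℕ}
    (hC : T.pathHypergraph.IsOddColoring k C) :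
    T.IsOddOnPaths (fun v => (⟨C v, Finset.mem_Icc.2 (hC.1 v (Set.mem_univ v))⟩ :
      Finset.Icc 1 k)) := by
  classical
  intro s u v p hp hps h0
  obtain ⟨c, hc⟩ := hC.2 {w | w ∈ p.support} ⟨u, v, p, hp, rfl⟩
  have hset : {w | w ∈ {w | w ∈ p.support} ∧ C w = c} = ((s.filter fun w => C w = c : Finset V) :
      Set V) := by
    ext x
    simp [hps]
  rw [Hypergraph.colorCount, hset, Set.ncard_coe_finset] at hc
  obtain ⟨a, ha⟩ := Finset.card_pos.1 hc.pos
  obtain ⟨-, rfl⟩ := Finset.mem_filter.1 ha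
  have := congrFun h0 ⟨C a, Finset.mem_Icc.2 (hC.1 a (Set.mem_univ a))⟩
  rw [parity, Finset.sum_apply] at this
  simp only [Pi.single_apply, Subtype.mk.injEq, Pi.zero_apply, Finset.sum_boole] at this
  rw [ZMod.natCast_eq_zero_iff_even] at this
  simp only [eq_comm (a := C a)] at this
  exact (Nat.not_even_iff_odd.2 hc) this

/-- An injective colouring works; this keeps the infima defining `CF` and `ODD` from being the
default value of `sInf ∅`. -/
theorem exists_isCFColoring [Finite V] (G : SimpleGraph V) :
    ∃ k C, G.pathHypergraph.IsCFColoring k C := by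
  obtain ⟨n, ⟨e⟩⟩ := Finite.exists_equiv_fin V
  refine ⟨n, fun v => (e v : ℕ) + 1, fun v _ => ⟨by lia, by lia⟩, ?_⟩
  rintro _ ⟨u, v, p, hp, rfl⟩
  refine ⟨e u + 1, Set.ncard_eq_one.2 ⟨u, ?_⟩⟩
  ext x
  simp only [Set.mem_ofPred_eq, add_left_inj, Fin.val_inj, e.injective.eq_iff,
    Set.mem_singleton_iff]
  exact ⟨fun h => h.2, fun h => ⟨h ▸ p.start_mem_support, h⟩⟩

theorem exists_isOddColoring_ODD [Finite V] (G : SimpleGraph V) :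
    ∃ C, G.pathHypergraph.IsOddColoring G.ODD C := by
  refine Nat.sInf_mem (s := {k | ∃ C, G.pathHypergraph.IsOddColoring k C}) ?_
  obtain ⟨k, C, h⟩ := G.exists_isCFColoring
  exact ⟨k, C, h.isOddColoring⟩

theorem ODD_le_CF [Finite V] (G : SimpleGraph V) : G.ODD ≤ G.CF := by
  obtain ⟨C, h⟩ := Nat.sInf_mem (s := {k | ∃ C, G.pathHypergraph.IsCFColoring k C})
    G.exists_isCFColoring
  exact Nat.sInf_le ⟨C, h.isOddColoring⟩

theorem IsTree.UM_le_ODD_pow_three [Finite V] (hT : T.IsTree) : T.UM ≤ T.ODD ^ 3 := by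
  have := Fintype.ofFinite V
  obtain ⟨r⟩ := hT.connected.nonempty
  obtain ⟨C, hC⟩ := T.exists_isOddColoring_ODD
  have hodd := isOddOnPaths_of_isOddColoring hC
  refine Nat.sInf_le ⟨_, isUMColoring_of_forall_exists_lt (fun v => ⟨?_, ?_⟩)
    fun u v hne h p hp => hodd.exists_rankColoring_lt hT r hne h p hp⟩
  · exact Nat.le_add_left _ _
  · simpa using hodd.rankColoring_le hT r v

end SimpleGraph

theorem mainTheorem1 :
    ∃ K : ℝ, ∀ (V : Type*) [Finite V] (T : SimpleGraph V), T.IsTree →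
      (T.ODD : ℝ) ≥ (T.UM : ℝ) ^ ((1 : ℝ) / 3) - K ∧
      T.CF ≥ T.ODD ∧
      (T.UM : ℝ) ≤ ((T.CF : ℝ) + K) ^ 3 := by
  refine ⟨0, fun V _ T hT => ?_⟩
  have h1 : (T.UM : ℝ) ≤ (T.ODD : ℝ) ^ 3 := by exact_mod_cast hT.UM_le_ODD_pow_three
  have h2 : (T.ODD : ℝ) ≤ T.CF := by exact_mod_cast T.ODD_le_CF
  refine ⟨?_, T.ODD_le_CF, ?_⟩
  · rw [sub_zero, ge_iff_le]
    calc (T.UM : ℝ) ^ ((1 : ℝ) / 3) ≤ ((T.ODD : ℝ) ^ 3) ^ ((1 : ℝ) / 3) := by gcongr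
      _ = T.ODD := by
        rw [← Real.rpow_natCast, ← Real.rpow_mul (by positivity)]
        norm_num
  · rw [add_zero]
    exact h1.trans (by gcongr)
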